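/- Let $\mathcal S,\mathcal A$ be sets, $\phi:\mathcal S\times\mathcal A\to\mathbb R^d$ a feature map with $\|\phi(s,a)\|_2\le L$ for all $(s,a)$, let $B\ge 0$ and $\Theta_B=\{\theta\in\mathbb R^d:\langle\mathbf 1,\theta\rangle=0,\ \|\theta\|_2\le B\}$, and let $n\ge 1$. A dataset is a tuple $\mathcal D=(s_i,a_i^0,a_i^1,y_i)_{i=1}^n$ with $s_i\in\mathcal S$, $a_i^0,a_i^1\in\mathcal A$, $y_i\in\{0,1\}$; put $x_i=\phi(s_i,a_i^1)-\phi(s_i,a_i^0)$. With $\mathrm{sig}(z)=1/(1+e^{-z})$, the log loss is $$\ell(\theta,(x,y))=-\big[\mathbf 1(y=1)\log \mathrm{sig}(x^\top\theta)+\mathbf 1(y=0)\log(1-\mathrm{sig}(x^\top\theta))\big].$$ For $\sigma\ge 0$ and $\beta>0$, objective perturbation draws $w\sim\mathcal N(0,\sigma^2 I_d)$, independently of the data, and returns $$\hat\theta_{\mathrm{obj}}(\mathcal D)=\operatorname*{arg\,min}_{\theta\in\Theta_B}\ \frac1n\sum_{i=1}^n\ell(\theta,(x_i,y_i))+\frac{\beta}{2n}\|\theta\|_2^2+\frac{w^\top\theta}{n}.$$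 **Theorem (privacy under standard DP).** Let $\epsilon>0$, $\delta\in(0,1)$, and $$\sigma\ \ge\ \frac{4L\sqrt{8\log(4/\delta)+2\epsilon}}{\epsilon},\qquad \beta\ \ge\ \frac{4L^2}{\epsilon},\qquad \beta>0 .$$ Then the minimizer $\hat\theta_{\mathrm{obj}}(\mathcal D)$ exists, is unique and depends measurably on $w$, for every dataset $\mathcal D$; and objective perturbation is $(\epsilon,\delta)$-differentially private in the central model under the standard neighboring relation: for any two datasets $\mathcal D,\mathcal D'$ of size $n$ that differ in at most one sample (whose features and label may both change arbitrarily) and every Borel set $E\subseteq\mathbb R^d$, $$\mathbb P[\hat\theta_{\mathrm{obj}}(\mathcal D)\in E]\ \le\ e^{\epsilon}\,\mathbb P[\hat\theta_{\mathrm{obj}}(\mathcal D')\in E]+\delta .$$ -/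

import Mathlib

open MeasureTheory ProbabilityTheory
open scoped ENNReal

namespace ObjPert

/-- One preference sample `(s, a⁰, a¹, y)`: a state, two actions and the label `y ∈ {0, 1}`
(`true` stands for `1`, i.e. action `a¹` is preferred). -/
structure Sample (S : Type*) (A : Type*) where
  state : S
  action0 : A
  action1 : A
  label : Bool

/-- A dataset of `n` samples. -/
abbrev Dataset (S : Type*) (A : Type*) (n : ℕ) := Fin n → Sample S A

/-- The neighboring relation of standard central DP: the two datasets differ in (at most) one
sample, and that sample may change arbitrarily, its features as well as its label. -/
def Neighbor {S A : Type*} {n : ℕ} (D D' : Dataset S A n) : Prop :=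
  ∃ j : Fin n, ∀ i : Fin n, i ≠ j → D i = D' i

/-- `(ε, δ)`-differential privacy of a randomized algorithm, given by the law `M D` of its output
on each input `D`, with respect to a neighboring relation `R`. -/
def IsDP {X Ω : Type*} [MeasurableSpace Ω] (R : X → X → Prop) (ε δ : ℝ)
    (M : X → Measure Ω) : Prop :=
  ∀ D D' : X, R D D' → ∀ E : Set Ω, MeasurableSet E →
    M D E ≤ ENNReal.ofReal (Real.exp ε) * M D' E + ENNReal.ofReal δ

/-- The parameter set `Θ_B = {θ ∈ ℝᵈ | ⟨𝟏, θ⟩ = 0, ‖θ‖ ≤ B}`. -/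
def paramSet (d : ℕ) (B : ℝ) : Set (EuclideanSpace ℝ (Fin d)) :=
  {θ | ∑ k, θ k = 0 ∧ ‖θ‖ ≤ B}

section Algorithm

variable {S A : Type*} {d n : ℕ}

/-- The differential feature `x = φ(s, a¹) - φ(s, a⁰)` of a sample. -/
noncomputable def diffFeature (φ : S → A → EuclideanSpace ℝ (Fin d)) (z : Sample S A) :
    EuclideanSpace ℝ (Fin d) :=
  φ z.state z.action1 - φ z.state z.action0

/-- The log loss `ℓ(θ, (x, y)) = -[1(y = 1) log σ(xᵀθ) + 1(y = 0) log (1 - σ(xᵀθ))]`, where `σ`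
is the sigmoid function. -/
noncomputable def logLoss (θ x : EuclideanSpace ℝ (Fin d)) (y : Bool) : ℝ :=
  -(if y then Real.log (Real.sigmoid (inner ℝ x θ))
    else Real.log (1 - Real.sigmoid (inner ℝ x θ)))

/-- The perturbed objective
`(1/n) ∑ᵢ ℓ(θ, (xᵢ, yᵢ)) + β/(2n) ‖θ‖² + wᵀθ / n`. -/
noncomputable def objective (φ : S → A → EuclideanSpace ℝ (Fin d)) (β : ℝ) (D : Dataset S A n)
    (w θ : EuclideanSpace ℝ (Fin d)) : ℝ :=
  (1 / (n : ℝ)) * ∑ i, logLoss θ (diffFeature φ (D i)) (D i).label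
    + β / (2 * (n : ℝ)) * ‖θ‖ ^ 2 + inner ℝ w θ / (n : ℝ)

/-- `θ` is a minimizer over `Θ_B` of the perturbed objective with noise vector `w`. -/
def IsMinimizer (φ : S → A → EuclideanSpace ℝ (Fin d)) (B β : ℝ) (D : Dataset S A n)
    (w θ : EuclideanSpace ℝ (Fin d)) : Prop :=
  θ ∈ paramSet d B ∧ IsMinOn (objective φ β D w) (paramSet d B) θ

/-- The objective perturbation estimator: the minimizer over `Θ_B` of the perturbed objective, as a
function of the noise vector `w` (some minimizer is chosen; it is unique in the cases
of interest). -/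
noncomputable def estimator (φ : S → A → EuclideanSpace ℝ (Fin d)) (B β : ℝ) (D : Dataset S A n)
    (w : EuclideanSpace ℝ (Fin d)) : EuclideanSpace ℝ (Fin d) :=
  Classical.epsilon (IsMinimizer φ B β D w)

/-- The Gaussian distribution `N(0, σ² I)` on `ℝᵈ`. -/
noncomputable def gaussianNoise (d : ℕ) (σ : ℝ) : Measure (EuclideanSpace ℝ (Fin d)) :=
  multivariateGaussian 0 ((σ ^ 2) • (1 : Matrix (Fin d) (Fin d) ℝ))

/-- Objective perturbation with Gaussian noise, as a randomized algorithm: the law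
of the estimator when `w ∼ N(0, σ² I)`. -/
noncomputable def objectivePerturbation (φ : S → A → EuclideanSpace ℝ (Fin d)) (B β σ : ℝ)
    (D : Dataset S A n) : Measure (EuclideanSpace ℝ (Fin d)) :=
  (gaussianNoise d σ).map (estimator φ B β D)

end Algorithm

end ObjPert

/-! The constraint makes the noise-to-output map non-injective in general, so densities of the
output are avoided: noises are compared instead. The minimizer `θ w` solves the variational
inequality of the gradient plus `w`. Let `g`, `g'` be the gradients of the differing sample in the
two datasets. Moving them between gradient and noise shows that the noise `w + g (θ w) - g' (θ w)`
gives on the second dataset the same output as `w` on the first.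

This transport factors through the problem without that sample, and each factor shifts the noise by
a scalar multiple of one feature vector. Solution maps are Lipschitz, hence differentiable almost
everywhere, so change of variables applies with rank-one Jacobians. `deriv_solution_le` gives the
bounds: removal has determinant at least `exp (-ε/4)`, addition at least 1 (`lintegral_remove_le`,
`lintegral_add_le`). The Gaussian density changes by a factor at most `exp (3ε/4)` unless the noise
has a large component along one of the two features, an event of probability at most `δ`
(`gaussianDensity_le`, `gaussianNoise_le_abs_inner`). -/

namespace ObjPert

/-! ### Strongly monotone variational inequalities and their solution maps -/

section VariationalInequality

variable {V : Type*} [NormedAddCommGroup V] [InnerProductSpace ℝ V]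

/-- `θ` solves the variational inequality for the vector field `G + w` on `K`. -/
def IsVISol (K : Set V) (G : V → V) (w θ : V) : Prop :=
  θ ∈ K ∧ ∀ η ∈ K, 0 ≤ inner ℝ (G θ + w) (η - θ)

/-- `G` is strongly monotone with modulus `β`. -/
def StronglyMonotone (β : ℝ) (G : V → V) : Prop :=
  ∀ θ η, β * ‖θ - η‖ ^ 2 ≤ inner ℝ (G θ - G η) (θ - η)

variable {K : Set V} {G : V → V} {β : ℝ}

/-- Test each inequality at the other solution and add. -/
lemma IsVISol.inner_sub_le {w₁ w₂ θ₁ θ₂ : V} (h₁ : IsVISol K G w₁ θ₁) (h₂ : IsVISol K G w₂ θ₂) :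
    inner ℝ (G θ₁ - G θ₂) (θ₁ - θ₂) ≤ -inner ℝ (w₁ - w₂) (θ₁ - θ₂) := by
  have e₁ := h₁.2 θ₂ h₂.1
  have e₂ := h₂.2 θ₁ h₁.1
  simp only [inner_add_left, inner_sub_left, inner_sub_right] at *
  linarith

lemma IsVISol.norm_sub_le (hβ : 0 < β) (hG : StronglyMonotone β G) {w₁ w₂ θ₁ θ₂ : V}
    (h₁ : IsVISol K G w₁ θ₁) (h₂ : IsVISol K G w₂ θ₂) :
    ‖θ₁ - θ₂‖ ≤ β⁻¹ * ‖w₁ - w₂‖ := by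
  have e₁ := h₁.inner_sub_le h₂
  have e₂ := hG θ₁ θ₂
  have e₃ := neg_le_of_abs_le (abs_real_inner_le_norm (w₁ - w₂) (θ₁ - θ₂))
  rw [inv_mul_eq_div, le_div_iff₀' hβ]
  rcases (norm_nonneg (θ₁ - θ₂)).eq_or_lt with h0 | h0
  · rw [← h0]; simp
  · refine le_of_mul_le_mul_right ?_ h0
    nlinarith

lemma IsVISol.unique (hβ : 0 < β) (hG : StronglyMonotone β G) {w θ₁ θ₂ : V}
    (h₁ : IsVISol K G w θ₁) (h₂ : IsVISol K G w θ₂) : θ₁ = θ₂ := by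
  have := h₁.norm_sub_le hβ hG h₂
  rw [sub_self, norm_zero, mul_zero] at this
  exact sub_eq_zero.1 (norm_le_zero_iff.1 this)

/-- Yields both measurability and, via Rademacher, the almost everywhere derivative used in the
change of variables. -/
lemma lipschitzWith_of_isVISol (hβ : 0 < β) (hG : StronglyMonotone β G) {θ : V → V}
    (hθ : ∀ w, IsVISol K G w (θ w)) : LipschitzWith (β⁻¹).toNNReal θ := by
  refine LipschitzWith.of_dist_le_mul fun w₁ w₂ => ?_
  rw [dist_eq_norm, dist_eq_norm, Real.coe_toNNReal _ (inv_nonneg.2 hβ.le)]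
  exact (hθ w₁).norm_sub_le hβ hG (hθ w₂)

/-- Only the value of the field at the solution enters the inequality, so a term `g` can be absorbed
into the noise as the constant `g θ`. With uniqueness, this gives the transport identities. -/
lemma IsVISol.shift {g : V → V} {w θ : V} (h : IsVISol K (fun η => G η + g η) w θ) :
    IsVISol K G (w + g θ) θ := by
  refine ⟨h.1, fun η hη => ?_⟩
  have := h.2 η hη
  rwa [add_assoc, add_comm (g θ) w] at this

lemma IsVISol.unshift {g : V → V} {w θ : V} (h : IsVISol K G w θ) :
    IsVISol K (fun η => G η + g η) (w - g θ) θ := by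
  refine ⟨h.1, fun η hη => ?_⟩
  have := h.2 η hη
  have e : G θ + g θ + (w - g θ) = G θ + w := by abel
  simpa only [e] using this

/-- A minimizer over a convex set solves the variational inequality of the gradient. -/
lemma IsMinOn.isVISol (hK : Convex ℝ K) {F : V → ℝ}
    (hF : ∀ θ, HasFDerivAt F (innerSL ℝ (G θ)) θ) {w θ : V} (hθ : θ ∈ K)
    (hmin : IsMinOn (fun η => F η + inner ℝ w η) K θ) : IsVISol K G w θ := by
  refine ⟨hθ, fun η hη => ?_⟩
  have hd : HasFDerivAt (fun η => F η + inner ℝ w η) (innerSL ℝ (G θ) + innerSL ℝ w) θ :=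
    (hF θ).add (innerSL ℝ w).hasFDerivAt
  have := hmin.localize.hasFDerivWithinAt_nonneg hd.hasFDerivWithinAt
    (sub_mem_posTangentConeAt_of_segment_subset (hK.segment_subset hθ hη))
  simpa [inner_add_left] using this

lemma existsUnique_isMinOn (hK : Convex ℝ K) (hKc : IsCompact K) (hKn : K.Nonempty) (hβ : 0 < β)
    (hG : StronglyMonotone β G) {F : V → ℝ} (hF : ∀ θ, HasFDerivAt F (innerSL ℝ (G θ)) θ) (w : V) :
    ∃! θ, θ ∈ K ∧ IsMinOn (fun η => F η + inner ℝ w η) K θ := by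
  have hc : Continuous fun η => F η + inner ℝ w η :=
    (continuous_iff_continuousAt.2 fun θ => (hF θ).continuousAt).add (by fun_prop)
  obtain ⟨θ, hθ, hmin⟩ := hKc.exists_isMinOn hKn hc.continuousOn
  exact ⟨θ, ⟨hθ, hmin⟩, fun η hη =>
    (IsMinOn.isVISol hK hF hη.1 hη.2).unique hβ hG (IsMinOn.isVISol hK hF hθ hmin)⟩

/-- Derivative of the solution map in the direction of a rank-one term of the vector field. -/
lemma deriv_solution_le (hβ : 0 ≤ β) (hG : StronglyMonotone β G) {ψ : ℝ → ℝ} {x : V} {θ : V → V}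
    (hθ : ∀ w, IsVISol K (fun η => G η + ψ (inner ℝ x η) • x) w (θ w)) {w : V} {M : V →L[ℝ] V}
    (hM : HasFDerivAt θ M w) {c : ℝ} (hc : HasDerivAt ψ c (inner ℝ x (θ w))) :
    (β + c * ‖x‖ ^ 2) * inner ℝ x (M x) ^ 2 ≤ -(‖x‖ ^ 2 * inner ℝ x (M x)) := by
  set u : ℝ → ℝ := fun t => inner ℝ x (θ (w + t • x)) with hu
  have hl : HasDerivAt (fun t : ℝ => w + t • x) x 0 := by
    simpa using ((hasDerivAt_id (0 : ℝ)).smul_const x).const_add w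
  have hM' : HasFDerivAt θ M (w + (0 : ℝ) • x) := by simpa using hM
  have hud : HasDerivAt u (inner ℝ x (M x)) 0 :=
    (innerSL ℝ x).hasFDerivAt.comp_hasDerivAt 0 (hM'.comp_hasDerivAt 0 hl)
  have hc' : HasDerivAt ψ c (u 0) := by simpa [hu] using hc
  have hψu : HasDerivAt (ψ ∘ u) (c * inner ℝ x (M x)) 0 := hc'.comp 0 hud
  have hs := hasDerivAt_iff_tendsto_slope.1 hud
  have hp := hasDerivAt_iff_tendsto_slope.1 hψu
  have hL := ((hs.pow 2).const_mul β).add ((hp.mul hs).const_mul (‖x‖ ^ 2))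
  have hR := (hs.const_mul (‖x‖ ^ 2)).neg
  have key := le_of_tendsto_of_tendsto hL hR ?_
  · nlinarith
  · filter_upwards [self_mem_nhdsWithin] with t ht
    have ht : t ≠ 0 := ht
    have e₁ := (hθ (w + t • x)).inner_sub_le (hθ w)
    set Δ := θ (w + t • x) - θ w with hΔ
    have e₂ := hG (θ (w + t • x)) (θ w)
    have hxΔ : inner ℝ x Δ = u t - u 0 := by simp [hu, hΔ, inner_sub_right]
    -- Cauchy–Schwarz turns the strong monotonicity term in `Δ` into one in the scalar increment of
    -- `u`.
    have e₃ : (u t - u 0) ^ 2 ≤ ‖x‖ ^ 2 * ‖Δ‖ ^ 2 := by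
      rw [← hxΔ, ← mul_pow]
      exact sq_le_sq' (neg_le_of_abs_le (abs_real_inner_le_norm x Δ)) (real_inner_le_norm x Δ)
    have e₄ : β * ‖Δ‖ ^ 2 + (ψ (u t) - ψ (u 0)) * (u t - u 0) ≤ -(t * (u t - u 0)) := by
      have : (G (θ (w + t • x)) + ψ (inner ℝ x (θ (w + t • x))) • x)
          - (G (θ w) + ψ (inner ℝ x (θ w)) • x)
          = (G (θ (w + t • x)) - G (θ w)) + (ψ (u t) - ψ (u 0)) • x := by
        simp only [hu, zero_smul, add_zero, sub_smul]; abel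
      rw [this, inner_add_left, inner_smul_left, hxΔ, add_sub_cancel_left, inner_smul_left,
        hxΔ] at e₁
      simp only [conj_trivial] at e₁
      linarith
    have e₅ : β * (u t - u 0) ^ 2 + ‖x‖ ^ 2 * ((ψ (u t) - ψ (u 0)) * (u t - u 0))
        ≤ -(‖x‖ ^ 2 * (t * (u t - u 0))) := by
      have := mul_le_mul_of_nonneg_left e₄ (sq_nonneg ‖x‖)
      have := mul_le_mul_of_nonneg_left e₃ hβ
      linarith
    have ht2 : 0 < t ^ 2 := by positivity
    simp only [slope_def_field, sub_zero, Function.comp_apply]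
    -- The slope inequality is `e₅` divided by `t ^ 2`.
    refine le_of_mul_le_mul_left ?_ ht2
    have t₁ : t ^ 2 * (β * ((u t - u 0) / t) ^ 2
          + ‖x‖ ^ 2 * ((ψ (u t) - ψ (u 0)) / t * ((u t - u 0) / t)))
        = β * (u t - u 0) ^ 2 + ‖x‖ ^ 2 * ((ψ (u t) - ψ (u 0)) * (u t - u 0)) := by
      field_simp
    have t₂ : t ^ 2 * -(‖x‖ ^ 2 * ((u t - u 0) / t)) = -(‖x‖ ^ 2 * (t * (u t - u 0))) := by
      field_simp
    rw [t₁, t₂]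
    exact e₅

end VariationalInequality

/-! ### Change of variables for rank-one shifts -/

section ChangeOfVariables

variable {V : Type*} [NormedAddCommGroup V] [InnerProductSpace ℝ V] [FiniteDimensional ℝ V]
  [MeasurableSpace V] [BorelSpace V]

/-- Change of variables along `w ↦ w + ψ ⟪x, θ w⟫ • x` for a Lipschitz map `θ`, given a lower bound
`r` for its Jacobian determinant. -/
lemma lintegral_comp_rankOne_shift_le (μ : Measure V) [μ.IsAddHaarMeasure] {C : NNReal} {θ : V → V}
    (hθ : LipschitzWith C θ) {ψ ψ' : ℝ → ℝ} (hψ : ∀ u, HasDerivAt ψ (ψ' u) u) (x : V)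
    (hinj : Function.Injective fun w => w + ψ (inner ℝ x (θ w)) • x) (r : ℝ)
    (hr : ∀ (w : V) (M : V →L[ℝ] V), HasFDerivAt θ M w →
      r ≤ 1 + ψ' (inner ℝ x (θ w)) * inner ℝ x (M x)) (f : V → ℝ≥0∞) :
    ENNReal.ofReal r * ∫⁻ w, f (w + ψ (inner ℝ x (θ w)) • x) ∂μ ≤ ∫⁻ w, f w ∂μ := by
  set h : V → V := fun w => w + ψ (inner ℝ x (θ w)) • x with hh
  set s : Set V := {w | DifferentiableAt ℝ θ w} with hs
  have hsm : MeasurableSet s := measurableSet_of_differentiableAt ℝ θ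
  have hsae : s =ᵐ[μ] Set.univ := Filter.eventuallyEq_univ.2 hθ.ae_differentiableAt
  set h' : V → V →L[ℝ] V := fun w => ContinuousLinearMap.id ℝ V +
    (ψ' (inner ℝ x (θ w)) • (innerSL ℝ x).comp (fderiv ℝ θ w)).smulRight x with hh'
  have hd : ∀ w ∈ s, HasFDerivWithinAt h (h' w) s w := by
    intro w hw
    have h1 : HasFDerivAt (fun w => inner ℝ x (θ w)) ((innerSL ℝ x).comp (fderiv ℝ θ w)) w :=
      (innerSL ℝ x).hasFDerivAt.comp w (DifferentiableAt.hasFDerivAt hw)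
    have h2 := ((hψ _).comp_hasFDerivAt w h1).smul_const x
    exact ((hasFDerivAt_id w).add h2).hasFDerivWithinAt
  have hdet : ∀ w, (h' w).det = 1 + ψ' (inner ℝ x (θ w)) * inner ℝ x (fderiv ℝ θ w x) := by
    intro w
    -- Identity plus rank one is a transvection, with determinant one plus the functional at `x`.
    have : ((h' w : V →L[ℝ] V) : V →ₗ[ℝ] V) = LinearMap.transvection
        ((ψ' (inner ℝ x (θ w)) • (innerSL ℝ x).comp (fderiv ℝ θ w) : V →L[ℝ] ℝ) : V →ₗ[ℝ] ℝ) x := by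
      ext v
      simp [hh', LinearMap.transvection.apply]
    rw [ContinuousLinearMap.det, this, LinearMap.transvection.det]
    simp
  calc ENNReal.ofReal r * ∫⁻ w, f (h w) ∂μ
      = ∫⁻ w in s, ENNReal.ofReal r * f (h w) ∂μ := by
        rw [lintegral_const_mul' _ _ ENNReal.ofReal_ne_top, setLIntegral_congr hsae,
          setLIntegral_univ]
    _ ≤ ∫⁻ w in s, ENNReal.ofReal |(h' w).det| * f (h w) ∂μ := by
        refine setLIntegral_mono' hsm fun w hw => ?_
        gcongr
        rw [hdet]
        exact (hr w _ (DifferentiableAt.hasFDerivAt hw)).trans (le_abs_self _)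
    _ = ∫⁻ w in h '' s, f w ∂μ :=
        (lintegral_image_eq_lintegral_abs_det_fderiv_mul μ hsm hd hinj.injOn f).symm
    _ ≤ ∫⁻ w, f w ∂μ := setLIntegral_le_lintegral _ _

end ChangeOfVariables

/-! ### Density and one-dimensional tails of the Gaussian noise -/

section Gaussian

variable {d : ℕ}

/-- The density of `N(0, σ² I)`, with a free normalizing constant `c`. -/
noncomputable def gaussianDensity (d : ℕ) (c σ : ℝ) (w : EuclideanSpace ℝ (Fin d)) : ℝ≥0∞ :=
  ENNReal.ofReal (c * Real.exp (-(2 * σ ^ 2)⁻¹ * ‖w‖ ^ 2))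

lemma posSemidef_sq_smul_one (σ : ℝ) : ((σ ^ 2) • (1 : Matrix (Fin d) (Fin d) ℝ)).PosSemidef :=
  Matrix.PosSemidef.one.smul (sq_nonneg σ)

lemma charFun_gaussianNoise (σ : ℝ) (x : EuclideanSpace ℝ (Fin d)) :
    charFun (gaussianNoise d σ) x = Complex.exp (-(σ ^ 2 * ‖x‖ ^ 2 / 2 : ℝ)) := by
  rw [gaussianNoise, charFun_multivariateGaussian (posSemidef_sq_smul_one σ),
    EuclideanSpace.real_norm_sq_eq]
  congr 1
  simp [Matrix.smul_mulVec, dotProduct, Finset.mul_sum, Finset.sum_div]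
  exact Finset.sum_congr rfl fun i _ => by ring

/-- Both sides have the same characteristic function. The normalizing constant stays anonymous
because only density ratios are needed. -/
lemma gaussianNoise_eq_withDensity {σ : ℝ} (hσ : 0 < σ) :
    ∃ c : ℝ, 0 ≤ c ∧ gaussianNoise d σ = volume.withDensity (gaussianDensity d c σ) := by
  set b : ℝ := (2 * σ ^ 2)⁻¹ with hb
  have hb0 : 0 < b := by positivity
  have hbc : 0 < (b : ℂ).re := by simpa using hb0
  set Z : ℝ := (Real.pi / b) ^ (d / 2 : ℝ) with hZ
  have hZ0 : 0 < Z := by positivity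
  refine ⟨Z⁻¹, by positivity, ?_⟩
  have hint : Integrable (fun w : EuclideanSpace ℝ (Fin d) => Real.exp (-b * ‖w‖ ^ 2)) := by
    have := (GaussianFourier.integrable_cexp_neg_mul_sq_norm_add
      (V := EuclideanSpace ℝ (Fin d)) hbc 0 0).re
    refine this.congr (Filter.Eventually.of_forall fun w => ?_)
    simp only [zero_mul, add_zero]
    rw [← Complex.ofReal_neg, ← Complex.ofReal_pow, ← Complex.ofReal_mul, ← Complex.ofReal_exp]
    exact Complex.ofReal_re _
  have hmeas : Measurable (gaussianDensity d Z⁻¹ σ) := by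
    unfold gaussianDensity; fun_prop
  have hfin : IsFiniteMeasure (volume.withDensity (gaussianDensity d Z⁻¹ σ)) :=
    isFiniteMeasure_withDensity_ofReal (hint.const_mul Z⁻¹).2
  have : IsFiniteMeasure (gaussianNoise d σ) := by unfold gaussianNoise; infer_instance
  refine Measure.ext_of_charFun (funext fun t => ?_)
  rw [charFun_gaussianNoise, charFun_apply, integral_withDensity_eq_integral_toReal_smul hmeas
    (Filter.Eventually.of_forall fun w => ENNReal.ofReal_lt_top)]
  have key := GaussianFourier.integral_cexp_neg_mul_sq_norm_add
    (V := EuclideanSpace ℝ (Fin d)) hbc Complex.I t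
  have : ∀ w : EuclideanSpace ℝ (Fin d), (gaussianDensity d Z⁻¹ σ w).toReal •
      Complex.exp (inner ℝ w t * Complex.I)
      = (Z : ℂ)⁻¹ * Complex.exp (-b * ‖w‖ ^ 2 + Complex.I * inner ℝ t w) := by
    intro w
    rw [gaussianDensity, ENNReal.toReal_ofReal (by positivity), Complex.exp_add, real_inner_comm w t,
      Complex.real_smul, ← hb]
    push_cast
    rw [mul_comm Complex.I]
    ring
  simp_rw [this]
  rw [integral_const_mul, key]
  have hZc : ((Real.pi : ℂ) / b) ^ ((Module.finrank ℝ (EuclideanSpace ℝ (Fin d)) : ℂ) / 2) = Z := by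
    rw [hZ, Complex.ofReal_cpow (by positivity)]
    simp
  rw [hZc, ← mul_assoc, inv_mul_cancel₀ (by exact_mod_cast hZ0.ne'), one_mul, Complex.I_sq, hb]
  congr 1
  have : (σ : ℂ) ≠ 0 := by exact_mod_cast hσ.ne'
  push_cast
  field_simp
  norm_num

lemma map_inner_gaussianNoise (σ : ℝ) (x : EuclideanSpace ℝ (Fin d)) :
    (gaussianNoise d σ).map (fun w => inner ℝ x w)
      = gaussianReal 0 (σ ^ 2 * ‖x‖ ^ 2).toNNReal := by
  have : IsFiniteMeasure (gaussianNoise d σ) := by unfold gaussianNoise; infer_instance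
  refine Measure.ext_of_charFun (funext fun t => ?_)
  have h : charFun ((gaussianNoise d σ).map (fun w => inner ℝ x w)) t
      = charFun (gaussianNoise d σ) (t • x) := by
    rw [charFun_apply, charFun_apply, integral_map (by fun_prop) (by fun_prop)]
    simp [inner_smul_right, real_inner_comm, mul_comm]
  rw [h, charFun_gaussianNoise, charFun_gaussianReal, norm_smul, Real.coe_toNNReal _ (by positivity)]
  congr 1
  simp only [mul_pow, Real.norm_eq_abs, sq_abs]
  push_cast
  ring

/-- The projection on `x` is a real Gaussian, so the two-sided Chernoff bound does not depend on the
dimension. -/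
lemma gaussianNoise_le_abs_inner {σ : ℝ} {R t : ℝ} {x : EuclideanSpace ℝ (Fin d)}
    (hσ : 0 < σ) (hR : 0 < R) (hx : ‖x‖ ≤ R) (ht : 0 ≤ t) :
    gaussianNoise d σ {w | σ * R * t ≤ |inner ℝ x w|}
      ≤ ENNReal.ofReal (2 * Real.exp (-t ^ 2 / 2)) := by
  have : IsProbabilityMeasure (gaussianNoise d σ) := by unfold gaussianNoise; infer_instance
  have hsub : HasSubgaussianMGF (fun w => inner ℝ x w) ((σ * R) ^ 2).toNNReal (gaussianNoise d σ) := by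
    refine ⟨fun s => ?_, fun s => ?_⟩
    · have := integrable_exp_mul_gaussianReal (μ := 0) (v := (σ ^ 2 * ‖x‖ ^ 2).toNNReal) s
      rw [← map_inner_gaussianNoise] at this
      exact this.comp_measurable (by fun_prop)
    · rw [mgf_gaussianReal (map_inner_gaussianNoise σ x), Real.coe_toNNReal _ (by positivity),
        Real.coe_toNNReal _ (by positivity), zero_mul, zero_add, mul_pow]
      gcongr
  have htail : ∀ X : EuclideanSpace ℝ (Fin d) → ℝ,
      HasSubgaussianMGF X ((σ * R) ^ 2).toNNReal (gaussianNoise d σ) →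
      (gaussianNoise d σ).real {w | σ * R * t ≤ X w} ≤ Real.exp (-t ^ 2 / 2) := by
    intro X hX
    refine (hX.measure_ge_le (by positivity)).trans_eq ?_
    rw [Real.coe_toNNReal _ (by positivity)]
    congr 1
    field_simp
  have hle : {w : EuclideanSpace ℝ (Fin d) | σ * R * t ≤ |inner ℝ x w|} ⊆
      {w | σ * R * t ≤ inner ℝ x w} ∪ {w | σ * R * t ≤ (-fun w => inner ℝ x w) w} := by
    intro w hw
    rw [Set.mem_ofPred_eq] at hw
    exact le_abs.1 hw
  rw [← ofReal_measureReal]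
  refine ENNReal.ofReal_le_ofReal ?_
  calc _ ≤ _ := measureReal_mono hle
    _ ≤ _ := measureReal_union_le _ _
    _ ≤ _ := add_le_add (htail _ hsub) (htail _ hsub.neg)
    _ = _ := by ring

end Gaussian

/-! ### Log loss and its gradient -/

section LogLoss

/-- The derivative of the log loss with label `y` in the score `u = xᵀθ`. -/
noncomputable def scoreDeriv (y : Bool) (u : ℝ) : ℝ :=
  Real.sigmoid u - if y then 1 else 0

lemma hasDerivAt_scoreDeriv (y : Bool) (u : ℝ) :
    HasDerivAt (scoreDeriv y) (Real.sigmoid u * (1 - Real.sigmoid u)) u :=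
  (Real.hasDerivAt_sigmoid u).sub_const _

lemma abs_scoreDeriv_le_one (y : Bool) (u : ℝ) : |scoreDeriv y u| ≤ 1 := by
  have h0 := Real.sigmoid_nonneg u
  have h1 := Real.sigmoid_le_one u
  rw [abs_le]
  cases y <;> simp [scoreDeriv] <;> constructor <;> linarith

lemma scoreDeriv_monotone (y : Bool) : Monotone (scoreDeriv y) := fun _ _ h =>
  sub_le_sub_right (Real.sigmoid_monotone h) _

variable {d : ℕ}

lemma hasFDerivAt_logLoss (x θ : EuclideanSpace ℝ (Fin d)) (y : Bool) :
    HasFDerivAt (fun θ => logLoss θ x y) (innerSL ℝ (scoreDeriv y (inner ℝ x θ) • x)) θ := by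
  have hx : HasFDerivAt (fun θ : EuclideanSpace ℝ (Fin d) => inner ℝ x θ) (innerSL ℝ x) θ :=
    (innerSL ℝ x).hasFDerivAt
  rw [map_smul]
  set u : ℝ := inner ℝ x θ
  have h0 := Real.sigmoid_pos u
  have h1 := sub_pos.2 (Real.sigmoid_lt_one u)
  cases y with
  | true =>
    have h : HasDerivAt (fun u => -Real.log (Real.sigmoid u)) (scoreDeriv true u) u := by
      refine ((Real.hasDerivAt_sigmoid u).log h0.ne').neg.congr_deriv ?_
      rw [scoreDeriv, if_pos rfl]
      field_simp
      ring
    refine (h.comp_hasFDerivAt θ hx).congr_of_eventuallyEq (Filter.Eventually.of_forall fun η => ?_)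
    simp [logLoss]
  | false =>
    have h : HasDerivAt (fun u => -Real.log (1 - Real.sigmoid u)) (scoreDeriv false u) u := by
      refine (((Real.hasDerivAt_sigmoid u).const_sub 1).log h1.ne').neg.congr_deriv ?_
      rw [scoreDeriv, if_neg Bool.false_ne_true]
      field_simp
      ring
    refine (h.comp_hasFDerivAt θ hx).congr_of_eventuallyEq (Filter.Eventually.of_forall fun η => ?_)
    simp [logLoss]

/-- The regularized empirical loss over the samples indexed by `s`. -/
noncomputable def regLoss {ι : Type*} (s : Finset ι) (x : ι → EuclideanSpace ℝ (Fin d))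
    (y : ι → Bool) (β : ℝ) (θ : EuclideanSpace ℝ (Fin d)) : ℝ :=
  ∑ i ∈ s, logLoss θ (x i) (y i) + β / 2 * ‖θ‖ ^ 2

/-- The gradient of `regLoss`. -/
noncomputable def regGrad {ι : Type*} (s : Finset ι) (x : ι → EuclideanSpace ℝ (Fin d))
    (y : ι → Bool) (β : ℝ) (θ : EuclideanSpace ℝ (Fin d)) : EuclideanSpace ℝ (Fin d) :=
  ∑ i ∈ s, scoreDeriv (y i) (inner ℝ (x i) θ) • x i + β • θ

variable {ι : Type*} (s : Finset ι) (x : ι → EuclideanSpace ℝ (Fin d)) (y : ι → Bool) (β : ℝ)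

lemma hasFDerivAt_regLoss (θ : EuclideanSpace ℝ (Fin d)) :
    HasFDerivAt (regLoss s x y β) (innerSL ℝ (regGrad s x y β θ)) θ := by
  have h1 := HasFDerivAt.fun_sum (u := s) fun i _ => hasFDerivAt_logLoss (x i) θ (y i)
  have h2 := ((hasStrictFDerivAt_norm_sq θ).hasFDerivAt.const_mul (β / 2))
  refine (h1.add h2).congr_fderiv ?_
  ext v
  simp [regGrad]
  ring

lemma stronglyMonotone_regGrad : StronglyMonotone β (regGrad s x y β) := by
  intro θ η
  have : regGrad s x y β θ - regGrad s x y β η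
      = ∑ i ∈ s, (scoreDeriv (y i) (inner ℝ (x i) θ) - scoreDeriv (y i) (inner ℝ (x i) η)) • x i
        + β • (θ - η) := by
    simp only [regGrad, sub_smul, Finset.sum_sub_distrib, smul_sub]
    abel
  rw [this, inner_add_left, sum_inner, inner_smul_left, real_inner_self_eq_norm_sq, conj_trivial]
  refine le_add_of_nonneg_left (Finset.sum_nonneg fun i _ => ?_)
  rw [inner_smul_left, conj_trivial, inner_sub_right]
  rcases le_total (inner ℝ (x i) θ) (inner ℝ (x i) η) with h | h
  · exact mul_nonneg_of_nonpos_of_nonpos (sub_nonpos.2 (scoreDeriv_monotone _ h))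
      (sub_nonpos.2 h)
  · exact mul_nonneg (sub_nonneg.2 (scoreDeriv_monotone _ h)) (sub_nonneg.2 h)

lemma regGrad_insert [DecidableEq ι] {j : ι} (hj : j ∈ s) (θ : EuclideanSpace ℝ (Fin d)) :
    regGrad s x y β θ
      = regGrad (s.erase j) x y β θ + scoreDeriv (y j) (inner ℝ (x j) θ) • x j := by
  rw [regGrad, regGrad, ← Finset.add_sum_erase s _ hj]
  abel

end LogLoss

/-! ### The estimator as a solution map -/

section Minimizer

variable {S A : Type*} {d n : ℕ}

lemma convex_paramSet (d : ℕ) (B : ℝ) : Convex ℝ (paramSet d B) := by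
  intro θ hθ η hη a b ha hb hab
  refine ⟨?_, ?_⟩
  · simp [Finset.sum_add_distrib, ← Finset.mul_sum, hθ.1, hη.1]
  · have := convex_closedBall (0 : EuclideanSpace ℝ (Fin d)) B
      (mem_closedBall_zero_iff.2 hθ.2) (mem_closedBall_zero_iff.2 hη.2) ha hb hab
    exact mem_closedBall_zero_iff.1 this

lemma isCompact_paramSet (d : ℕ) (B : ℝ) : IsCompact (paramSet d B) := by
  have : paramSet d B = Metric.closedBall 0 B ∩ {θ | ∑ k, θ k = 0} := by
    ext θ
    simp [paramSet, and_comm]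
  rw [this]
  exact (isCompact_closedBall _ _).inter_right (isClosed_eq (by fun_prop) continuous_const)

lemma zero_mem_paramSet (d : ℕ) {B : ℝ} (hB : 0 ≤ B) : 0 ∈ paramSet d B := by
  simp [paramSet, hB]

lemma objective_eq (hn : 0 < n) (φ : S → A → EuclideanSpace ℝ (Fin d)) (β : ℝ)
    (D : Dataset S A n) (w θ : EuclideanSpace ℝ (Fin d)) :
    objective φ β D w θ = (n : ℝ)⁻¹ * (regLoss Finset.univ (fun i => diffFeature φ (D i))
      (fun i => (D i).label) β θ + inner ℝ w θ) := by
  have : (n : ℝ) ≠ 0 := by positivity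
  rw [objective, regLoss]
  field_simp

lemma isMinimizer_iff (hn : 0 < n) (φ : S → A → EuclideanSpace ℝ (Fin d)) (B β : ℝ)
    (D : Dataset S A n) (w θ : EuclideanSpace ℝ (Fin d)) :
    IsMinimizer φ B β D w θ ↔ θ ∈ paramSet d B ∧
      IsMinOn (fun η => regLoss Finset.univ (fun i => diffFeature φ (D i))
        (fun i => (D i).label) β η + inner ℝ w η) (paramSet d B) θ := by
  have hn' : (0 : ℝ) < (n : ℝ)⁻¹ := by positivity
  simp only [IsMinimizer, isMinOn_iff, objective_eq hn, mul_le_mul_iff_right₀ hn']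

lemma existsUnique_isMinimizer (hn : 0 < n) (φ : S → A → EuclideanSpace ℝ (Fin d)) {B β : ℝ}
    (hB : 0 ≤ B) (hβ : 0 < β) (D : Dataset S A n) (w : EuclideanSpace ℝ (Fin d)) :
    ∃! θ, IsMinimizer φ B β D w θ := by
  simp only [isMinimizer_iff hn]
  exact existsUnique_isMinOn (convex_paramSet d B) (isCompact_paramSet d B)
    ⟨0, zero_mem_paramSet d hB⟩ hβ (stronglyMonotone_regGrad _ _ _ β)
    (hasFDerivAt_regLoss _ _ _ β) w

lemma isVISol_estimator (hn : 0 < n) (φ : S → A → EuclideanSpace ℝ (Fin d)) {B β : ℝ}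
    (hB : 0 ≤ B) (hβ : 0 < β) (D : Dataset S A n) (w : EuclideanSpace ℝ (Fin d)) :
    IsVISol (paramSet d B) (regGrad Finset.univ (fun i => diffFeature φ (D i))
      (fun i => (D i).label) β) w (estimator φ B β D w) := by
  have h : IsMinimizer φ B β D w (estimator φ B β D w) :=
    Classical.epsilon_spec (existsUnique_isMinimizer hn φ hB hβ D w).exists
  rw [isMinimizer_iff hn] at h
  exact IsMinOn.isVISol (convex_paramSet d B) (hasFDerivAt_regLoss _ _ _ β) h.1 h.2

lemma measurable_estimator (hn : 0 < n) (φ : S → A → EuclideanSpace ℝ (Fin d)) {B β : ℝ}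
    (hB : 0 ≤ B) (hβ : 0 < β) (D : Dataset S A n) : Measurable (estimator φ B β D) :=
  (lipschitzWith_of_isVISol hβ (stronglyMonotone_regGrad _ _ _ β)
    (isVISol_estimator hn φ hB hβ D)).continuous.measurable

end Minimizer

/-! ### Transport between neighboring problems -/

section Privacy

variable {d : ℕ} {K : Set (EuclideanSpace ℝ (Fin d))}
  {G : EuclideanSpace ℝ (Fin d) → EuclideanSpace ℝ (Fin d)} {β : ℝ}

lemma sigmoid_deriv_mem (u : ℝ) : 0 ≤ Real.sigmoid u * (1 - Real.sigmoid u) ∧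
    Real.sigmoid u * (1 - Real.sigmoid u) ≤ 1 / 4 :=
  ⟨mul_nonneg (Real.sigmoid_nonneg u) (sub_nonneg.2 (Real.sigmoid_le_one u)),
    by nlinarith [sq_nonneg (2 * Real.sigmoid u - 1)]⟩

/-- The quadratic inequality forces `-m ≤ X / (β + c X)`, so `1 + c m ≥ β / (β + c X) ≥ 1 / (1 + ε)
≥ exp (-ε)`. -/
lemma exp_neg_le_one_add_mul {β c X m ε : ℝ} (hβ : 0 < β) (hc : 0 ≤ c)
    (hX : 0 ≤ X) (hcX : c * X ≤ β * ε)
    (h : (β + c * X) * m ^ 2 ≤ -(X * m)) : Real.exp (-ε) ≤ 1 + c * m := by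
  have hcX0 : 0 ≤ c * X := mul_nonneg hc hX
  have hq : 0 < β + c * X := by linarith
  have hm : (β + c * X) * (-m) ≤ X := by
    rcases lt_or_ge m 0 with hm | hm
    · refine le_of_mul_le_mul_right ?_ (neg_pos.2 hm)
      linarith
    · nlinarith
  have hle : β ≤ (β + c * X) * (1 + c * m) := by nlinarith
  have hexp : β + c * X ≤ β * Real.exp ε := by nlinarith [Real.add_one_le_exp ε]
  have hpos : 0 < 1 + c * m := by
    by_contra hneg
    nlinarith
  rw [Real.exp_neg, inv_le_iff_one_le_mul₀ (Real.exp_pos ε)]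
  have : β ≤ β * Real.exp ε * (1 + c * m) :=
    hle.trans (mul_le_mul_of_nonneg_right hexp hpos.le)
  refine le_of_mul_le_mul_left ?_ hβ
  linarith

/-- Removing one sample changes the law of the noise seen by a fixed output by at most `exp ε`. -/
lemma lintegral_remove_le {ε L : ℝ} (hβ : 0 < β) (hG : StronglyMonotone β G)
    {x : EuclideanSpace ℝ (Fin d)} (hx : ‖x‖ ≤ 2 * L) (hLβ : L ^ 2 ≤ β * ε) (y : Bool)
    {θ θ₀ : EuclideanSpace ℝ (Fin d) → EuclideanSpace ℝ (Fin d)}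
    (hθ : ∀ w, IsVISol K (fun η => G η + scoreDeriv y (inner ℝ x η) • x) w (θ w))
    (hG' : StronglyMonotone β (fun η => G η + scoreDeriv y (inner ℝ x η) • x))
    (hθ₀ : ∀ w, IsVISol K G w (θ₀ w)) (f : EuclideanSpace ℝ (Fin d) → ℝ≥0∞) :
    ENNReal.ofReal (Real.exp (-ε)) * ∫⁻ w, f (w + scoreDeriv y (inner ℝ x (θ w)) • x)
      ≤ ∫⁻ w, f w := by
  have hcomm : ∀ w, θ₀ (w + scoreDeriv y (inner ℝ x (θ w)) • x) = θ w := fun w =>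
    (hθ₀ _).unique hβ hG (IsVISol.shift (g := fun η => scoreDeriv y (inner ℝ x η) • x) (hθ w))
  refine lintegral_comp_rankOne_shift_le volume (lipschitzWith_of_isVISol hβ hG' hθ)
    (hasDerivAt_scoreDeriv y) x ?_ _ (fun w M hM => ?_) f
  -- The shifted noise determines the output through `θ₀`, hence the shift, hence `w`.
  · intro w₁ w₂ h
    have h' : θ w₁ = θ w₂ := by rw [← hcomm w₁, ← hcomm w₂]; exact congrArg θ₀ h
    simpa [h'] using h
  · obtain ⟨h1, h2⟩ := sigmoid_deriv_mem (inner ℝ x (θ w))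
    refine exp_neg_le_one_add_mul hβ h1 (sq_nonneg ‖x‖) ?_
      (deriv_solution_le hβ.le hG hθ hM (hasDerivAt_scoreDeriv y _))
    -- The sigmoid derivative is at most 1/4, which cancels the 4 in `(2L)²`.
    have : ‖x‖ ^ 2 ≤ (2 * L) ^ 2 := pow_le_pow_left₀ (norm_nonneg x) hx 2
    nlinarith [sq_nonneg ‖x‖]

/-- Adding one sample contracts the law of the noise seen by a fixed output. -/
lemma lintegral_add_le (hβ : 0 < β) (hG : StronglyMonotone β G)
    (x : EuclideanSpace ℝ (Fin d)) (y : Bool)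
    {θ θ₀ : EuclideanSpace ℝ (Fin d) → EuclideanSpace ℝ (Fin d)}
    (hθ : ∀ w, IsVISol K (fun η => G η + scoreDeriv y (inner ℝ x η) • x) w (θ w))
    (hG' : StronglyMonotone β (fun η => G η + scoreDeriv y (inner ℝ x η) • x))
    (hθ₀ : ∀ w, IsVISol K G w (θ₀ w)) (f : EuclideanSpace ℝ (Fin d) → ℝ≥0∞) :
    ∫⁻ w, f (w - scoreDeriv y (inner ℝ x (θ₀ w)) • x) ≤ ∫⁻ w, f w := by
  have hcomm : ∀ w, θ (w - scoreDeriv y (inner ℝ x (θ₀ w)) • x) = θ₀ w := fun w =>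
    (hθ _).unique hβ hG' (IsVISol.unshift (g := fun η => scoreDeriv y (inner ℝ x η) • x) (hθ₀ w))
  have key := lintegral_comp_rankOne_shift_le volume (lipschitzWith_of_isVISol hβ hG hθ₀)
    (ψ := fun u => -scoreDeriv y u) (fun u => (hasDerivAt_scoreDeriv y u).neg) x ?_ 1
    (fun w M hM => ?_) f
  · simpa [← sub_eq_add_neg] using key
  · intro w₁ w₂ h
    simp only [neg_smul, ← sub_eq_add_neg] at h
    have h' : θ₀ w₁ = θ₀ w₂ := by rw [← hcomm w₁, ← hcomm w₂]; exact congrArg θ h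
    simpa [h'] using h
  -- With `ψ = 0` the derivative bound reads `β m² ≤ -‖x‖² m`, so `m ≤ 0` and the determinant `1 -
  -- ψ' m` is at least 1.
  · have h := deriv_solution_le (x := x) (ψ := fun _ => 0) (c := 0) hβ.le hG (by simpa using hθ₀) hM
      (hasDerivAt_const _ _)
    have hm : inner ℝ x (M x) ≤ 0 := by
      rcases eq_or_ne x 0 with rfl | hx
      · simp
      · by_contra! hm
        have : 0 < ‖x‖ := norm_pos_iff.2 hx
        have : 0 < ‖x‖ ^ 2 * inner ℝ x (M x) := by positivity
        nlinarith [mul_nonneg hβ.le (sq_nonneg (inner ℝ x (M x)))]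
    have := mul_nonneg (sigmoid_deriv_mem (inner ℝ x (θ₀ w))).1 (neg_nonneg.2 hm)
    linarith

/-- For `v = a x - a' x'` the exponent changes by `(2⟪w, v⟫ + ‖v‖²) / (2σ²)`, where `w` enters only
through its products with `x` and `x'`. -/
lemma gaussianDensity_le {c σ R t ε : ℝ} (hc : 0 ≤ c) (hσ : 0 < σ)
    {w x x' : EuclideanSpace ℝ (Fin d)} (hx : ‖x‖ ≤ R) (hx' : ‖x'‖ ≤ R)
    (hw : |inner ℝ x w| ≤ σ * R * t) (hw' : |inner ℝ x' w| ≤ σ * R * t)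
    {a a' : ℝ} (ha : |a| ≤ 1) (ha' : |a'| ≤ 1)
    (hε : 2 * (R * t) * σ + 2 * R ^ 2 ≤ ε * σ ^ 2) :
    gaussianDensity d c σ w
      ≤ ENNReal.ofReal (Real.exp ε) * gaussianDensity d c σ (w + a • x - a' • x') := by
  rw [gaussianDensity, gaussianDensity, ← ENNReal.ofReal_mul (Real.exp_pos _).le, mul_left_comm,
    ← Real.exp_add]
  gcongr
  set v := a • x - a' • x' with hv
  have hvR : ‖v‖ ≤ 2 * R := by
    refine (norm_sub_le _ _).trans ?_
    rw [norm_smul, norm_smul, Real.norm_eq_abs, Real.norm_eq_abs]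
    nlinarith [norm_nonneg x, norm_nonneg x']
  have h1 : ‖v‖ ^ 2 ≤ 4 * R ^ 2 := by nlinarith [norm_nonneg v]
  have h2 : inner ℝ w v ≤ 2 * (σ * R * t) := by
    rw [hv, inner_sub_right, inner_smul_right, inner_smul_right, real_inner_comm x w,
      real_inner_comm x' w]
    have e1 : a * inner ℝ x w ≤ |inner ℝ x w| := by
      refine (le_abs_self _).trans ?_
      rw [abs_mul]; exact mul_le_of_le_one_left (abs_nonneg _) ha
    have e2 : -(a' * inner ℝ x' w) ≤ |inner ℝ x' w| := by
      refine (neg_le_abs _).trans ?_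
      rw [abs_mul]; exact mul_le_of_le_one_left (abs_nonneg _) ha'
    linarith
  rw [add_sub_assoc, ← hv, norm_add_sq_real]
  have hs : 0 < 2 * σ ^ 2 := by positivity
  have : (2 * σ ^ 2)⁻¹ * (2 * inner ℝ w v + ‖v‖ ^ 2) ≤ ε := by
    rw [inv_mul_le_iff₀ hs]
    linarith
  linarith

/-- Privacy of one replacement, for the solution maps of the variational inequalities. -/
theorem gaussianNoise_map_le {ε δ L σ : ℝ} (hβ : 0 < β) (hε : 0 < ε) (hδ₀ : 0 < δ) (hδ₁ : δ < 1)
    (hL : 0 < L) (hσ : 4 * L * Real.sqrt (8 * Real.log (4 / δ) + 2 * ε) / ε ≤ σ)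
    (hLβ : 4 * L ^ 2 / ε ≤ β) (hG : StronglyMonotone β G)
    {x x' : EuclideanSpace ℝ (Fin d)} (hx : ‖x‖ ≤ 2 * L) (hx' : ‖x'‖ ≤ 2 * L) (y y' : Bool)
    {θ θ₀ θ' : EuclideanSpace ℝ (Fin d) → EuclideanSpace ℝ (Fin d)}
    (hθ : ∀ w, IsVISol K (fun η => G η + scoreDeriv y (inner ℝ x η) • x) w (θ w))
    (hθ₀ : ∀ w, IsVISol K G w (θ₀ w))
    (hθ' : ∀ w, IsVISol K (fun η => G η + scoreDeriv y' (inner ℝ x' η) • x') w (θ' w))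
    (hGx : StronglyMonotone β (fun η => G η + scoreDeriv y (inner ℝ x η) • x))
    (hGx' : StronglyMonotone β (fun η => G η + scoreDeriv y' (inner ℝ x' η) • x'))
    {E : Set (EuclideanSpace ℝ (Fin d))} (hE : MeasurableSet E) :
    (gaussianNoise d σ).map θ E
      ≤ ENNReal.ofReal (Real.exp ε) * (gaussianNoise d σ).map θ' E + ENNReal.ofReal δ := by
  have hlog : 0 < Real.log (4 / δ) := Real.log_pos (by rw [lt_div_iff₀ hδ₀]; linarith)
  set Q := Real.sqrt (8 * Real.log (4 / δ) + 2 * ε) with hQ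
  have hQ2 : Q ^ 2 = 8 * Real.log (4 / δ) + 2 * ε := Real.sq_sqrt (by positivity)
  have hQ0 : 0 < Q := Real.sqrt_pos.2 (by positivity)
  have hσ0 : 0 < σ := lt_of_lt_of_le (by positivity) hσ
  -- Chosen so that each two-sided tail has mass at most `δ / 2`.
  set t := Real.sqrt (2 * Real.log (4 / δ)) with ht
  have ht2 : t ^ 2 = 2 * Real.log (4 / δ) := Real.sq_sqrt (by positivity)
  have ht0 : 0 ≤ t := Real.sqrt_nonneg _
  have hσε : 4 * L * Q ≤ σ * ε := (div_le_iff₀ hε).1 hσ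
  have htQ : 2 * t ≤ Q := by nlinarith
  -- With `R = 2L`: `b1` bounds the linear term by `εσ²/2`, `b2` the quadratic one by `εσ²/4`. The
  -- last quarter of `ε` pays for the Jacobian.
  have hbudget : 2 * (2 * L * t) * σ + 2 * (2 * L) ^ 2 ≤ 3 * ε / 4 * σ ^ 2 := by
    have b1 : 8 * L * t ≤ σ * ε := by nlinarith
    have b2 : 32 * L ^ 2 ≤ ε * σ ^ 2 := by
      have : (4 * L * Q) ^ 2 ≤ (σ * ε) ^ 2 := pow_le_pow_left₀ (by positivity) hσε 2
      have : 16 * L ^ 2 * (2 * ε) ≤ σ ^ 2 * ε * ε := by nlinarith [sq_nonneg L]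
      nlinarith
    nlinarith
  have htail : 2 * Real.exp (-t ^ 2 / 2) = δ / 2 := by
    rw [ht2, show -(2 * Real.log (4 / δ)) / 2 = -Real.log (4 / δ) by ring, Real.exp_neg,
      Real.exp_log (by positivity)]
    field_simp
    norm_num
  obtain ⟨c, hc, hν⟩ := gaussianNoise_eq_withDensity (d := d) hσ0
  set ν := gaussianNoise d σ with hνd
  set p := gaussianDensity d c σ with hp
  have hpm : Measurable p := by rw [hp]; unfold gaussianDensity; fun_prop
  have hθm : Measurable θ := (lipschitzWith_of_isVISol hβ hGx hθ).continuous.measurable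
  have hθm' : Measurable θ' := (lipschitzWith_of_isVISol hβ hGx' hθ').continuous.measurable
  set g : EuclideanSpace ℝ (Fin d) → EuclideanSpace ℝ (Fin d) :=
    fun η => scoreDeriv y (inner ℝ x η) • x with hg
  set g' : EuclideanSpace ℝ (Fin d) → EuclideanSpace ℝ (Fin d) :=
    fun η => scoreDeriv y' (inner ℝ x' η) • x' with hg'
  have hcomm : ∀ w, θ₀ (w + g (θ w)) = θ w := fun w =>
    (hθ₀ _).unique hβ hG (IsVISol.shift (g := g) (hθ w))
  have hcomm' : ∀ w, θ' (w - g' (θ₀ w)) = θ₀ w := fun w =>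
    (hθ' _).unique hβ hGx' (IsVISol.unshift (g := g') (hθ₀ w))
  set bad : Set (EuclideanSpace ℝ (Fin d)) :=
    {w | σ * (2 * L) * t ≤ |inner ℝ x w|} ∪ {w | σ * (2 * L) * t ≤ |inner ℝ x' w|} with hbad
  have hbadν : ν bad ≤ ENNReal.ofReal δ := by
    refine (measure_union_le _ _).trans ?_
    have h1 := gaussianNoise_le_abs_inner hσ0 (by positivity) hx ht0
    have h2 := gaussianNoise_le_abs_inner hσ0 (by positivity) hx' ht0
    rw [htail] at h1 h2
    refine (add_le_add h1 h2).trans_eq ?_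
    rw [← ENNReal.ofReal_add (by positivity) (by positivity), add_halves]
  set f : EuclideanSpace ℝ (Fin d) → ℝ≥0∞ := (θ' ⁻¹' E).indicator p with hf
  have hmain : ∫⁻ w, f (w + g (θ w) - g' (θ w)) ≤
      ENNReal.ofReal (Real.exp (ε / 4)) * ∫⁻ w, f w := by
    have hLβ' : L ^ 2 ≤ β * (ε / 4) := by
      rw [div_le_iff₀ hε] at hLβ
      linarith
    -- Removal is applied to the integrand already composed with the addition shift; `hcomm` then
    -- replaces `θ₀` at the shifted noise by `θ w`.
    have h1 := lintegral_remove_le hβ hG hx hLβ' y hθ hGx hθ₀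
      (fun w => f (w - g' (θ₀ w)))
    have h2 := lintegral_add_le hβ hG x' y' hθ' hGx' hθ₀ f
    have h3 := h1.trans h2
    change _ * ∫⁻ w, f (w + g (θ w) - g' (θ₀ (w + g (θ w)))) ≤ _ at h3
    simp only [hcomm] at h3
    calc ∫⁻ w, f (w + g (θ w) - g' (θ w))
        = ENNReal.ofReal (Real.exp (ε / 4)) * (ENNReal.ofReal (Real.exp (-(ε / 4)))
            * ∫⁻ w, f (w + g (θ w) - g' (θ w))) := by
          rw [← mul_assoc, ← ENNReal.ofReal_mul (Real.exp_pos _).le, ← Real.exp_add,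
            add_neg_cancel, Real.exp_zero, ENNReal.ofReal_one, one_mul]
      _ ≤ _ := by gcongr
  have hpoint : ∀ w ∈ θ ⁻¹' E \ bad,
      p w ≤ ENNReal.ofReal (Real.exp (3 * ε / 4)) * f (w + g (θ w) - g' (θ w)) := by
    rintro w ⟨hwE, hwb⟩
    simp only [hbad, Set.mem_union, Set.mem_ofPred_eq, not_or, not_le] at hwb
    have hmem : w + g (θ w) - g' (θ w) ∈ θ' ⁻¹' E := by
      have := hcomm' (w + g (θ w))
      rw [hcomm] at this
      rw [Set.mem_preimage, this]
      exact hwE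
    rw [hf, Set.indicator_of_mem hmem]
    exact gaussianDensity_le hc hσ0 hx hx' hwb.1.le hwb.2.le (abs_scoreDeriv_le_one _ _)
      (abs_scoreDeriv_le_one _ _) hbudget
  have hbm : MeasurableSet bad :=
    (measurableSet_le measurable_const (by fun_prop)).union
      (measurableSet_le measurable_const (by fun_prop))
  have hgood : ν (θ ⁻¹' E \ bad) ≤ ENNReal.ofReal (Real.exp ε) * ν (θ' ⁻¹' E) := by
    rw [hν, withDensity_apply _ ((hθm hE).diff hbm), withDensity_apply _ (hθm' hE),
      ← lintegral_indicator (hθm' hE)]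
    calc ∫⁻ w in θ ⁻¹' E \ bad, p w
        ≤ ∫⁻ w in θ ⁻¹' E \ bad, ENNReal.ofReal (Real.exp (3 * ε / 4)) *
            f (w + g (θ w) - g' (θ w)) := setLIntegral_mono' ((hθm hE).diff hbm) hpoint
      _ ≤ ∫⁻ w, ENNReal.ofReal (Real.exp (3 * ε / 4)) * f (w + g (θ w) - g' (θ w)) :=
          setLIntegral_le_lintegral _ _
      _ = ENNReal.ofReal (Real.exp (3 * ε / 4)) * ∫⁻ w, f (w + g (θ w) - g' (θ w)) :=
          lintegral_const_mul' _ _ ENNReal.ofReal_ne_top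
      _ ≤ ENNReal.ofReal (Real.exp (3 * ε / 4)) *
            (ENNReal.ofReal (Real.exp (ε / 4)) * ∫⁻ w, f w) := by gcongr
      _ = ENNReal.ofReal (Real.exp ε) * ∫⁻ w, f w := by
          rw [← mul_assoc, ← ENNReal.ofReal_mul (Real.exp_pos _).le, ← Real.exp_add]
          congr 4
          ring
  rw [Measure.map_apply hθm hE, Measure.map_apply hθm' hE]
  calc ν (θ ⁻¹' E) ≤ ν (θ ⁻¹' E \ bad ∪ bad) := measure_mono (by simp)
    _ ≤ ν (θ ⁻¹' E \ bad) + ν bad := measure_union_le _ _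
    _ ≤ _ := add_le_add hgood hbadν

end Privacy

/-! ### Differential privacy of objective perturbation -/

section Main

variable {S A : Type*} {d n : ℕ}

lemma norm_diffFeature_le {φ : S → A → EuclideanSpace ℝ (Fin d)} {L : ℝ}
    (hφ : ∀ s a, ‖φ s a‖ ≤ L) (z : Sample S A) : ‖diffFeature φ z‖ ≤ 2 * L := by
  refine (norm_sub_le _ _).trans ?_
  linarith [hφ z.state z.action0, hφ z.state z.action1]

/-- Covers `L = 0`, where `σ` may vanish and the noise need not have a density. At score zero both
labels have the same loss, so the objective ignores the data. -/
lemma estimator_eq_of_diffFeature_eq_zero {φ : S → A → EuclideanSpace ℝ (Fin d)}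
    (h : ∀ z, diffFeature φ z = 0) (B β : ℝ) (D D' : Dataset S A n) :
    estimator φ B β D = estimator φ B β D' := by
  have h2 : (1 : ℝ) - 2⁻¹ = 2⁻¹ := by norm_num
  have hobj : objective φ β D = objective φ β D' := by
    funext w θ
    simp [objective, logLoss, h, h2]
  unfold estimator IsMinimizer
  rw [hobj]

lemma isDP_objectivePerturbation (hn : 0 < n) {φ : S → A → EuclideanSpace ℝ (Fin d)}
    {L B ε δ σ β : ℝ} (hφ : ∀ s a, ‖φ s a‖ ≤ L) (hB : 0 ≤ B)
    (hε : 0 < ε) (hδ₀ : 0 < δ) (hδ₁ : δ < 1)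
    (hσ : 4 * L * Real.sqrt (8 * Real.log (4 / δ) + 2 * ε) / ε ≤ σ)
    (hβ₀ : 0 < β) (hβ : 4 * L ^ 2 / ε ≤ β) :
    IsDP Neighbor ε δ (fun D : Dataset S A n => objectivePerturbation φ B β σ D) := by
  classical
  rintro D D' ⟨j, hj⟩ E hE
  have hL : 0 ≤ L := (norm_nonneg _).trans (hφ (D j).state (D j).action0)
  rcases hL.eq_or_lt with rfl | hL
  · have h0 : ∀ z, diffFeature φ z = 0 := fun z => by
      simpa using norm_diffFeature_le hφ z
    simp only [objectivePerturbation, estimator_eq_of_diffFeature_eq_zero h0 B β D D']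
    refine le_add_right (le_mul_of_one_le_left' ?_)
    rw [← ENNReal.ofReal_one]
    exact ENNReal.ofReal_le_ofReal (Real.one_le_exp hε.le)
  -- `G` is the gradient of the samples other than `j` with the full regularizer, shared by both
  -- datasets.
  · set G := regGrad (Finset.univ.erase j) (fun i => diffFeature φ (D i))
      (fun i => (D i).label) β with hG
    have hG' : G = regGrad (Finset.univ.erase j) (fun i => diffFeature φ (D' i))
        (fun i => (D' i).label) β := by
      funext θ
      rw [hG, regGrad, regGrad]
      congr 1
      refine Finset.sum_congr rfl fun i hi => ?_
      rw [hj i (Finset.ne_of_mem_erase hi)]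
    have e : regGrad Finset.univ (fun i => diffFeature φ (D i)) (fun i => (D i).label) β
        = fun η => G η + scoreDeriv (D j).label (inner ℝ (diffFeature φ (D j)) η) •
          diffFeature φ (D j) :=
      funext fun η => regGrad_insert _ _ _ β (Finset.mem_univ j) η
    have e' : regGrad Finset.univ (fun i => diffFeature φ (D' i)) (fun i => (D' i).label) β
        = fun η => G η + scoreDeriv (D' j).label (inner ℝ (diffFeature φ (D' j)) η) •
          diffFeature φ (D' j) := by
      rw [hG']
      exact funext fun η => regGrad_insert _ _ _ β (Finset.mem_univ j) η
    have hsol : ∀ w, ∃ θ, IsVISol (paramSet d B) G w θ := fun w => by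
      obtain ⟨θ, ⟨h1, h2⟩, -⟩ := existsUnique_isMinOn (convex_paramSet d B)
        (isCompact_paramSet d B) ⟨0, zero_mem_paramSet d hB⟩ hβ₀
        (stronglyMonotone_regGrad (Finset.univ.erase j) _ _ β)
        (hasFDerivAt_regLoss _ (fun i => diffFeature φ (D i)) (fun i => (D i).label) β) w
      exact ⟨θ, IsMinOn.isVISol (convex_paramSet d B) (hasFDerivAt_regLoss _ _ _ β) h1 h2⟩
    choose θ₀ hθ₀ using hsol
    exact gaussianNoise_map_le hβ₀ hε hδ₀ hδ₁ hL hσ hβ (stronglyMonotone_regGrad _ _ _ β)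
      (norm_diffFeature_le hφ (D j)) (norm_diffFeature_le hφ (D' j)) (D j).label (D' j).label
      (fun w => e ▸ isVISol_estimator hn φ hB hβ₀ D w) hθ₀
      (fun w => e' ▸ isVISol_estimator hn φ hB hβ₀ D' w)
      (e ▸ stronglyMonotone_regGrad _ _ _ β) (e' ▸ stronglyMonotone_regGrad _ _ _ β) hE

end Main

end ObjPert

theorem mainTheorem12 {S : Type*} {A : Type*} {d n : ℕ} (hn : 0 < n)
    (φ : S → A → EuclideanSpace ℝ (Fin d)) (L B ε δ σ β : ℝ)
    (hφ : ∀ s a, ‖φ s a‖ ≤ L) (hB : 0 ≤ B)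
    (hε : 0 < ε) (hδ₀ : 0 < δ) (hδ₁ : δ < 1)
    (hσ : 4 * L * Real.sqrt (8 * Real.log (4 / δ) + 2 * ε) / ε ≤ σ)
    (hβ₀ : 0 < β) (hβ : 4 * L ^ 2 / ε ≤ β) :
    -- the minimizer exists and is unique, and depends measurably on the noise
    (∀ (D : ObjPert.Dataset S A n) (w : EuclideanSpace ℝ (Fin d)),
      ∃! θ, ObjPert.IsMinimizer φ B β D w θ) ∧
    (∀ D : ObjPert.Dataset S A n, Measurable (ObjPert.estimator φ B β D)) ∧
    -- the algorithm is differentially private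
    ObjPert.IsDP ObjPert.Neighbor ε δ
      (fun D : ObjPert.Dataset S A n => ObjPert.objectivePerturbation φ B β σ D) := by
  exact ⟨fun D w => ObjPert.existsUnique_isMinimizer hn φ hB hβ₀ D w,
    fun D => ObjPert.measurable_estimator hn φ hB hβ₀ D,
    ObjPert.isDP_objectivePerturbation hn hφ hB hε hδ₀ hδ₁ hσ hβ₀ hβ⟩
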